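/- Let $\mathcal B$ be a bicategory, with composition written in diagrammatic order: $A\otimes C\colon X\to Z$ for $A\colon X\to Y$, $C\colon Y\to Z$. Suppose $\mathcal B$ is biclosed: for all $A\colon X\to Y$, $C\colon X\to Z$ there is a right extension $A\multimap C\colon Y\to Z$ with an evaluation $A\otimes(A\multimap C)\to C$ inducing bijections between 2-cells $P\to A\multimap C$ and $A\otimes P\to C$, and for all $A\colon X\to Y$, $C\colon Z\to Y$ there is a right lifting $C\mathbin{\circ\!-}A\colon Z\to X$ with an evaluation $(C\mathbin{\circ\!-}A)\otimes A\to C$ inducing bijections between 2-cells $P\to C\mathbin{\circ\!-}A$ and $P\otimes A\to C$. Let $\{D_X\colon X\to X\}$ be a cyclic dualizing family, that is: for every $A\colon X\to Y$ the canonical 2-cell $\delta_{A,Y}\colon A\to (D_Y\mathbin{\circ\!-}A)\multimap D_Y$ is invertible, and there are invertible 2-cells $\theta_A\colon (D_Y\mathbin{\circ\!-}A)\to(A\multimap D_X)$, natural in $A$, such that $\theta_{D_Y\circ- A}\cdot(D_X\mathbin{\circ\!-}\theta_A)\cdot\delta_{X,A}=\delta_{A,Y}$, where $\delta_{X,A}\colon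 A\to D_X\mathbin{\circ\!-}(A\multimap D_X)$ is canonical. (So $\mathcal B$ is a Girard bicategory.) Put $A^\perp=A\multimap D_X\colon Y\to X$, and let $\epsilon_A\colon A^\perp\otimes A\to D_Y$ be $\theta_A^{-1}$ followed by evaluation. Then $\mathcal B$ is a linear bicategory whose second composition is, on 1-cells and 2-cells, $A\oplus B=(B^\perp\otimes A^\perp)^\perp$, with identity 1-cells $\top_X^\perp$, where $\top_X$ is the identity 1-cell of $X$ for $\otimes$. That is, $\oplus$ underlies a second bicategory structure with the same 0-cells and hom-categories, and there are natural linear distributions $$\delta^L\colon A\otimes(B\oplus C)\to(A\otimes B)\oplus C,\qquad \delta^R\colon (A\oplus B)\otimes C\to A\oplus(B\otimes C)$$ satisfying the usual coherence conditions (two for the units of $\otimes$, two for the units of $\oplus$, three for the associator of $\otimes$, three for the associator of $\oplus$). Moreover the distributions can be taken to be the following. For $A\colon X\to Y$, $B\colon Y\to Z$ the following 2-cells are invertible: * $m_{A,B}\colon (A^\perp\multimap B)\to A\oplus B$, the transpose of $B^\perp\otimes A^\perp\otimes(A^\perp\multimap B)\to B^\perp\otimes B\xrightarrow{\epsilon_B}D_Z$;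 * $n_{A,B}\colon (A\mathbin{\circ\!-}B^\perp)\to A\oplus B$, the transpose of $B^\perp\otimes A^\perp\otimes(A\mathbin{\circ\!-}B^\perp)\to B^\perp\otimes B^{\perp\perp}\to D_Z$, where $A^\perp\otimes(A\mathbin{\circ\!-}B^\perp)\to D_Y\mathbin{\circ\!-}B^\perp\xrightarrow{\theta}B^{\perp\perp}$ is obtained by transposing $A^\perp\otimes(A\mathbin{\circ\!-}B^\perp)\otimes B^\perp\to A^\perp\otimes A\xrightarrow{\epsilon_A}D_Y$. Under $m_{B,C}$ and $m_{A\otimes B,C}$, $\delta^L$ corresponds to the 2-cell $A\otimes(B^\perp\multimap C)\to(A\otimes B)^\perp\multimap C$ that is the transpose of $(A\otimes B)^\perp\otimes A\otimes(B^\perp\multimap C)\to B^\perp\otimes(B^\perp\multimap C)\to C$, where $(A\otimes B)^\perp\otimes A\to B^\perp$ is $\theta_B$ after the transpose of $\epsilon_{A\otimes B}$. Under $n_{A,B}$ and $n_{A,B\otimes C}$, $\delta^R$ corresponds to the 2-cell $(A\mathbin{\circ\!-}B^\perp)\otimes C\to A\mathbin{\circ\!-}(B\otimes C)^\perp$ that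 is the transpose of $(A\mathbin{\circ\!-}B^\perp)\otimes C\otimes(B\otimes C)^\perp\to(A\mathbin{\circ\!-}B^\perp)\otimes B^\perp\to A$, where $C\otimes(B\otimes C)^\perp\to B^\perp$ is the transpose of the evaluation $(B\otimes C)\otimes(B\otimes C)^\perp\to D$. -/

import Mathlib

open CategoryTheory Bicategory

universe w v u

namespace GirardBicat

/-! Composition of 1-cells is written in diagrammatic order: for `A : X ⟶ Y` and `C : Y ⟶ Z`,
the composite `A ≫ C : X ⟶ Z` is the tensor product of `A` and `C`. -/

/-- A biclosed bicategory: all right extensions and all right liftings exist (and are chosen). -/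
class Biclosed (B : Type u) [Bicategory.{w, v} B] where
  /-- the right extension of `C` along `A` -/
  rightExt {X Y Z : B} (A : X ⟶ Y) (C : X ⟶ Z) : RightExtension A C
  /-- its universal property -/
  rightExtIsKan {X Y Z : B} (A : X ⟶ Y) (C : X ⟶ Z) : (rightExt A C).IsKan
  /-- the right lifting of `C` through `A` -/
  rightLift {X Y Z : B} (A : X ⟶ Y) (C : Z ⟶ Y) : RightLift A C
  /-- its universal property -/
  rightLiftIsKan {X Y Z : B} (A : X ⟶ Y) (C : Z ⟶ Y) : (rightLift A C).IsKan

section Biclosed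

variable {B : Type u} [Bicategory.{w, v} B] [Biclosed B] {X Y Z : B}

/-- The right extension `A ⊸ C` of `C` along `A` (the right hom). -/
def rhom (A : X ⟶ Y) (C : X ⟶ Z) : Y ⟶ Z := (Biclosed.rightExt A C).extension

/-- The evaluation 2-cell from `A ⊗ (A ⊸ C)` to `C`. -/
def rev (A : X ⟶ Y) (C : X ⟶ Z) : A ≫ rhom A C ⟶ C := (Biclosed.rightExt A C).counit

/-- The 2-cell from `P` to `A ⊸ C` that corresponds to a 2-cell from `A ⊗ P` to `C`. -/
def rcurry {A : X ⟶ Y} {C : X ⟶ Z} {P : Y ⟶ Z} (f : A ≫ P ⟶ C) : P ⟶ rhom A C :=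
  CostructuredArrow.IsUniversal.lift (Biclosed.rightExtIsKan A C) (RightExtension.mk P f)

/-- The right lifting `C ⟜ A` of `C` through `A` (the left hom). -/
def lhom (C : Z ⟶ Y) (A : X ⟶ Y) : Z ⟶ X := (Biclosed.rightLift A C).lift

/-- The evaluation 2-cell from `(C ⟜ A) ⊗ A` to `C`. -/
def lev (C : Z ⟶ Y) (A : X ⟶ Y) : lhom C A ≫ A ⟶ C := (Biclosed.rightLift A C).counit

/-- The 2-cell from `P` to `C ⟜ A` that corresponds to a 2-cell from `P ⊗ A` to `C`. -/
def lcurry {C : Z ⟶ Y} {A : X ⟶ Y} {P : Z ⟶ X} (f : P ≫ A ⟶ C) : P ⟶ lhom C A :=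
  CostructuredArrow.IsUniversal.lift (Biclosed.rightLiftIsKan A C) (RightLift.mk P f)

theorem rcurry_rev {A : X ⟶ Y} {C : X ⟶ Z} {P : Y ⟶ Z} (f : A ≫ P ⟶ C) :
    A ◁ rcurry f ≫ rev A C = f :=
  CostructuredArrow.IsUniversal.fac (Biclosed.rightExtIsKan A C) (RightExtension.mk P f)

theorem rhom_ext {A : X ⟶ Y} {C : X ⟶ Z} {P : Y ⟶ Z} {f g : P ⟶ rhom A C}
    (h : A ◁ f ≫ rev A C = A ◁ g ≫ rev A C) : f = g :=
  CostructuredArrow.IsUniversal.hom_ext (Biclosed.rightExtIsKan A C) h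

theorem lcurry_lev {C : Z ⟶ Y} {A : X ⟶ Y} {P : Z ⟶ X} (f : P ≫ A ⟶ C) :
    lcurry f ▷ A ≫ lev C A = f :=
  CostructuredArrow.IsUniversal.fac (Biclosed.rightLiftIsKan A C) (RightLift.mk P f)

theorem lhom_ext {C : Z ⟶ Y} {A : X ⟶ Y} {P : Z ⟶ X} {f g : P ⟶ lhom C A}
    (h : f ▷ A ≫ lev C A = g ▷ A ≫ lev C A) : f = g :=
  CostructuredArrow.IsUniversal.hom_ext (Biclosed.rightLiftIsKan A C) h

/-- Contravariance of `A ⊸ C` in `A`. -/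
def rhomMap {A A' : X ⟶ Y} (f : A ⟶ A') (C : X ⟶ Z) : rhom A' C ⟶ rhom A C :=
  rcurry (f ▷ rhom A' C ≫ rev A' C)

/-- Contravariance of `C ⟜ A` in `A`. -/
def lhomMap (C : Z ⟶ Y) {A A' : X ⟶ Y} (f : A ⟶ A') : lhom C A' ⟶ lhom C A :=
  lcurry (lhom C A' ◁ f ≫ lev C A')

/-- For a family `D` of endo-1-cells, the canonical 2-cell from `A` to `(D_Y ⟜ A) ⊸ D_Y`. -/
def toRhomLhom (D : ∀ X : B, X ⟶ X) (A : X ⟶ Y) : A ⟶ rhom (lhom (D Y) A) (D Y) :=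
  rcurry (lev (D Y) A)

/-- For a family `D` of endo-1-cells, the canonical 2-cell from `A` to `D_X ⟜ (A ⊸ D_X)`. -/
def toLhomRhom (D : ∀ X : B, X ⟶ X) (A : X ⟶ Y) : A ⟶ lhom (D X) (rhom A (D X)) :=
  lcurry (rev A (D X))

end Biclosed

/-- A cyclic dualizing family of 1-cells in a biclosed bicategory. A Girard bicategory is a
biclosed bicategory that has one. -/
structure CyclicDualizingFamily (B : Type u) [Bicategory.{w, v} B] [Biclosed B] where
  /-- the 1-cells of the family -/
  D (X : B) : X ⟶ X
  /-- the family is dualizing -/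
  dualizing {X Y : B} (A : X ⟶ Y) : IsIso (toRhomLhom D A)
  /-- the invertible 2-cells `θ_A` from `D_Y ⟜ A` to `A ⊸ D_X` -/
  θ {X Y : B} (A : X ⟶ Y) : lhom (D Y) A ≅ rhom A (D X)
  /-- `θ_A` is natural in `A` -/
  θ_naturality {X Y : B} {A A' : X ⟶ Y} (f : A ⟶ A') :
    lhomMap (D Y) f ≫ (θ A).hom = (θ A').hom ≫ rhomMap f (D X)
  /-- the two canonical 2-cells into the double duals agree up to `θ` -/
  cyclic {X Y : B} (A : X ⟶ Y) :
    toLhomRhom D A ≫ lhomMap (D X) (θ A).hom ≫ (θ (lhom (D Y) A)).hom = toRhomLhom D A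

/-- The data of a second composition on the 0-cells and hom-categories of a bicategory: the
composite of 1-cells, its action on 2-cells (in each variable), and the identity 1-cells. -/
structure SecondComposition (B : Type u) [Bicategory.{w, v} B] where
  /-- the composite `A ⊕ C` -/
  oplus {X Y Z : B} (A : X ⟶ Y) (C : Y ⟶ Z) : X ⟶ Z
  /-- the identity 1-cells for `⊕` -/
  bot (X : B) : X ⟶ X
  /-- the 2-cell `A ⊕ g` -/
  oplusLeft {X Y Z : B} (A : X ⟶ Y) {C C' : Y ⟶ Z} (g : C ⟶ C') : oplus A C ⟶ oplus A C'
  /-- the 2-cell `f ⊕ C` -/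
  oplusRight {X Y Z : B} {A A' : X ⟶ Y} (f : A ⟶ A') (C : Y ⟶ Z) : oplus A C ⟶ oplus A' C

/-- Structure 2-cells and laws that make a second composition into a second bicategory structure
with the same 0-cells and hom-categories; the fields are those of `Bicategory`. -/
structure SecondBicategory {B : Type u} [Bicategory.{w, v} B] (P : SecondComposition B) where
  /-- the associator of `⊕` -/
  assoc {W X Y Z : B} (A : W ⟶ X) (C : X ⟶ Y) (E : Y ⟶ Z) :
    P.oplus (P.oplus A C) E ≅ P.oplus A (P.oplus C E)
  /-- the left unitor of `⊕` -/
  leftUnit {X Y : B} (A : X ⟶ Y) : P.oplus (P.bot X) A ≅ A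
  /-- the right unitor of `⊕` -/
  rightUnit {X Y : B} (A : X ⟶ Y) : P.oplus A (P.bot Y) ≅ A
  oplusLeft_id {X Y Z : B} (A : X ⟶ Y) (C : Y ⟶ Z) : P.oplusLeft A (𝟙 C) = 𝟙 (P.oplus A C)
  oplusLeft_comp {X Y Z : B} (A : X ⟶ Y) {C C' C'' : Y ⟶ Z} (g : C ⟶ C') (g' : C' ⟶ C'') :
    P.oplusLeft A (g ≫ g') = P.oplusLeft A g ≫ P.oplusLeft A g'
  bot_oplusLeft {X Y : B} {A A' : X ⟶ Y} (f : A ⟶ A') :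
    P.oplusLeft (P.bot X) f = (leftUnit A).hom ≫ f ≫ (leftUnit A').inv
  comp_oplusLeft {W X Y Z : B} (A : W ⟶ X) (C : X ⟶ Y) {E E' : Y ⟶ Z} (h : E ⟶ E') :
    P.oplusLeft (P.oplus A C) h =
      (assoc A C E).hom ≫ P.oplusLeft A (P.oplusLeft C h) ≫ (assoc A C E').inv
  id_oplusRight {X Y Z : B} (A : X ⟶ Y) (C : Y ⟶ Z) : P.oplusRight (𝟙 A) C = 𝟙 (P.oplus A C)
  comp_oplusRight {X Y Z : B} {A A' A'' : X ⟶ Y} (f : A ⟶ A') (f' : A' ⟶ A'') (C : Y ⟶ Z) :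
    P.oplusRight (f ≫ f') C = P.oplusRight f C ≫ P.oplusRight f' C
  oplusRight_bot {X Y : B} {A A' : X ⟶ Y} (f : A ⟶ A') :
    P.oplusRight f (P.bot Y) = (rightUnit A).hom ≫ f ≫ (rightUnit A').inv
  oplusRight_comp {W X Y Z : B} {A A' : W ⟶ X} (f : A ⟶ A') (C : X ⟶ Y) (E : Y ⟶ Z) :
    P.oplusRight f (P.oplus C E) =
      (assoc A C E).inv ≫ P.oplusRight (P.oplusRight f C) E ≫ (assoc A' C E).hom
  oplus_assoc {W X Y Z : B} (A : W ⟶ X) {C C' : X ⟶ Y} (g : C ⟶ C') (E : Y ⟶ Z) :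
    P.oplusRight (P.oplusLeft A g) E =
      (assoc A C E).hom ≫ P.oplusLeft A (P.oplusRight g E) ≫ (assoc A C' E).inv
  oplus_exchange {X Y Z : B} {A A' : X ⟶ Y} {C C' : Y ⟶ Z} (f : A ⟶ A') (g : C ⟶ C') :
    P.oplusLeft A g ≫ P.oplusRight f C' = P.oplusRight f C ≫ P.oplusLeft A' g
  pentagon {V W X Y Z : B} (A : V ⟶ W) (C : W ⟶ X) (E : X ⟶ Y) (F : Y ⟶ Z) :
    P.oplusRight (assoc A C E).hom F ≫ (assoc A (P.oplus C E) F).hom ≫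
        P.oplusLeft A (assoc C E F).hom =
      (assoc (P.oplus A C) E F).hom ≫ (assoc A C (P.oplus E F)).hom
  triangle {X Y Z : B} (A : X ⟶ Y) (C : Y ⟶ Z) :
    (assoc A (P.bot Y) C).hom ≫ P.oplusLeft A (leftUnit C).hom =
      P.oplusRight (rightUnit A).hom C

/-- The second bicategory structure as a `Bicategory` in the sense of Mathlib, with the same
1-cells, the same 2-cells and the same vertical composition. -/
abbrev SecondBicategory.toBicategory {B : Type u} [Bicategory.{w, v} B] {P : SecondComposition B}
    (S : SecondBicategory P) : Bicategory.{w, v} B where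
  Hom X Y := X ⟶ Y
  id := P.bot
  comp A C := P.oplus A C
  homCategory X Y := inferInstanceAs (Category (X ⟶ Y))
  whiskerLeft A _ _ g := P.oplusLeft A g
  whiskerRight f C := P.oplusRight f C
  associator := S.assoc
  leftUnitor := S.leftUnit
  rightUnitor := S.rightUnit
  whiskerLeft_id := S.oplusLeft_id
  whiskerLeft_comp A _ _ _ g g' := S.oplusLeft_comp A g g'
  id_whiskerLeft f := S.bot_oplusLeft f
  comp_whiskerLeft A C _ _ h := S.comp_oplusLeft A C h
  id_whiskerRight := S.id_oplusRight
  comp_whiskerRight f f' C := S.comp_oplusRight f f' C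
  whiskerRight_id f := S.oplusRight_bot f
  whiskerRight_comp f C E := S.oplusRight_comp f C E
  whisker_assoc A _ _ g E := S.oplus_assoc A g E
  whisker_exchange f g := S.oplus_exchange f g
  pentagon := S.pentagon
  triangle := S.triangle

/-- A linear bicategory whose first composition `⊗` is that of the bicategory `B` and whose second
composition `⊕` is `P`: a second bicategory structure together with the two natural linear
distributions, subject to the coherence conditions of Cockett, Koslowski and Seely. -/
structure LinearBicategory {B : Type u} [Bicategory.{w, v} B] (P : SecondComposition B)
    extends SecondBicategory P where
  /-- the linear distribution from `A ⊗ (C ⊕ E)` to `(A ⊗ C) ⊕ E` -/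
  distL {W X Y Z : B} (A : W ⟶ X) (C : X ⟶ Y) (E : Y ⟶ Z) :
    A ≫ P.oplus C E ⟶ P.oplus (A ≫ C) E
  /-- the linear distribution from `(A ⊕ C) ⊗ E` to `A ⊕ (C ⊗ E)` -/
  distR {W X Y Z : B} (A : W ⟶ X) (C : X ⟶ Y) (E : Y ⟶ Z) :
    P.oplus A C ≫ E ⟶ P.oplus A (C ≫ E)
  -- naturality of the linear distributions in each variable
  distL_naturality₁ {W X Y Z : B} {A A' : W ⟶ X} (f : A ⟶ A') (C : X ⟶ Y) (E : Y ⟶ Z) :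
    f ▷ P.oplus C E ≫ distL A' C E = distL A C E ≫ P.oplusRight (f ▷ C) E
  distL_naturality₂ {W X Y Z : B} (A : W ⟶ X) {C C' : X ⟶ Y} (g : C ⟶ C') (E : Y ⟶ Z) :
    A ◁ P.oplusRight g E ≫ distL A C' E = distL A C E ≫ P.oplusRight (A ◁ g) E
  distL_naturality₃ {W X Y Z : B} (A : W ⟶ X) (C : X ⟶ Y) {E E' : Y ⟶ Z} (h : E ⟶ E') :
    A ◁ P.oplusLeft C h ≫ distL A C E' = distL A C E ≫ P.oplusLeft (A ≫ C) h
  distR_naturality₁ {W X Y Z : B} {A A' : W ⟶ X} (f : A ⟶ A') (C : X ⟶ Y) (E : Y ⟶ Z) :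
    P.oplusRight f C ▷ E ≫ distR A' C E = distR A C E ≫ P.oplusRight f (C ≫ E)
  distR_naturality₂ {W X Y Z : B} (A : W ⟶ X) {C C' : X ⟶ Y} (g : C ⟶ C') (E : Y ⟶ Z) :
    P.oplusLeft A g ▷ E ≫ distR A C' E = distR A C E ≫ P.oplusLeft A (g ▷ E)
  distR_naturality₃ {W X Y Z : B} (A : W ⟶ X) (C : X ⟶ Y) {E E' : Y ⟶ Z} (h : E ⟶ E') :
    P.oplus A C ◁ h ≫ distR A C E' = distR A C E ≫ P.oplusLeft A (C ◁ h)
  -- the linear distributions and the units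
  distL_top {X Y Z : B} (C : X ⟶ Y) (E : Y ⟶ Z) :
    distL (𝟙 X) C E ≫ P.oplusRight (λ_ C).hom E = (λ_ (P.oplus C E)).hom
  distR_top {X Y Z : B} (A : X ⟶ Y) (C : Y ⟶ Z) :
    distR A C (𝟙 Z) ≫ P.oplusLeft A (ρ_ C).hom = (ρ_ (P.oplus A C)).hom
  distL_bot {X Y Z : B} (A : X ⟶ Y) (C : Y ⟶ Z) :
    distL A C (P.bot Z) ≫ (rightUnit (A ≫ C)).hom = A ◁ (rightUnit C).hom
  distR_bot {X Y Z : B} (C : X ⟶ Y) (E : Y ⟶ Z) :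
    distR (P.bot X) C E ≫ (leftUnit (C ≫ E)).hom = (leftUnit C).hom ▷ E
  -- the linear distributions and the associator of `⊗`
  distL_assoc {V W X Y Z : B} (A : V ⟶ W) (C : W ⟶ X) (E : X ⟶ Y) (F : Y ⟶ Z) :
    distL (A ≫ C) E F ≫ P.oplusRight (α_ A C E).hom F =
      (α_ A C (P.oplus E F)).hom ≫ A ◁ distL C E F ≫ distL A (C ≫ E) F
  distR_assoc {V W X Y Z : B} (A : V ⟶ W) (C : W ⟶ X) (E : X ⟶ Y) (F : Y ⟶ Z) :
    distR A C E ▷ F ≫ distR A (C ≫ E) F ≫ P.oplusLeft A (α_ C E F).hom =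
      (α_ (P.oplus A C) E F).hom ≫ distR A C (E ≫ F)
  distL_distR {V W X Y Z : B} (A : V ⟶ W) (C : W ⟶ X) (E : X ⟶ Y) (F : Y ⟶ Z) :
    distL A C E ▷ F ≫ distR (A ≫ C) E F =
      (α_ A (P.oplus C E) F).hom ≫ A ◁ distR C E F ≫ distL A C (E ≫ F)
  -- the linear distributions and the associator of `⊕`
  distL_oplus_assoc {V W X Y Z : B} (A : V ⟶ W) (C : W ⟶ X) (E : X ⟶ Y) (F : Y ⟶ Z) :
    distL A (P.oplus C E) F ≫ P.oplusRight (distL A C E) F ≫ (assoc (A ≫ C) E F).hom =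
      A ◁ (assoc C E F).hom ≫ distL A C (P.oplus E F)
  distR_oplus_assoc {V W X Y Z : B} (A : V ⟶ W) (C : W ⟶ X) (E : X ⟶ Y) (F : Y ⟶ Z) :
    (assoc A C E).hom ▷ F ≫ distR A (P.oplus C E) F ≫ P.oplusLeft A (distR C E F) =
      distR (P.oplus A C) E F ≫ (assoc A C (E ≫ F)).hom
  distR_distL {V W X Y Z : B} (A : V ⟶ W) (C : W ⟶ X) (E : X ⟶ Y) (F : Y ⟶ Z) :
    distL (P.oplus A C) E F ≫ P.oplusRight (distR A C E) F ≫ (assoc A (C ≫ E) F).hom =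
      distR A C (P.oplus E F) ≫ P.oplusLeft A (distL C E F)

namespace CyclicDualizingFamily

variable {B : Type u} [Bicategory.{w, v} B] [Biclosed B] (G : CyclicDualizingFamily B)
  {W X Y Z : B}

/-- The dual `A^⊥ = A ⊸ D_X` of `A : X ⟶ Y`. -/
def perp (A : X ⟶ Y) : Y ⟶ X := rhom A (G.D X)

/-- The contravariant action of the dual on 2-cells. -/
def perpMap {A A' : X ⟶ Y} (f : A ⟶ A') : G.perp A' ⟶ G.perp A := rhomMap f (G.D X)

/-- The composition `A ⊕ C = (C^⊥ ⊗ A^⊥)^⊥`, on 1-cells and 2-cells, with the identity 1-cells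
`X^⊥`, the duals of the identity 1-cells. -/
def oplusComposition : SecondComposition B where
  oplus A C := G.perp (G.perp C ≫ G.perp A)
  bot X := G.perp (𝟙 X)
  oplusLeft A _ _ g := G.perpMap (G.perpMap g ▷ G.perp A)
  oplusRight f C := G.perpMap (G.perp C ◁ G.perpMap f)

/-- The evaluation from `A^⊥ ⊗ A` to `D_Y`: the inverse of `θ_A`, followed by the evaluation
of `D_Y ⟜ A`. -/
def perpEval (A : X ⟶ Y) : G.perp A ≫ A ⟶ G.D Y := (G.θ A).inv ▷ A ≫ lev (G.D Y) A

/-- The 2-cell from `A^⊥ ⊸ C` to `A ⊕ C` which corresponds to the composite of evaluations from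
`(C^⊥ ⊗ A^⊥) ⊗ (A^⊥ ⊸ C)` to `C^⊥ ⊗ C` and on to `D_Z`. -/
def fromRhom (A : X ⟶ Y) (C : Y ⟶ Z) :
    rhom (G.perp A) C ⟶ G.oplusComposition.oplus A C :=
  rcurry ((α_ (G.perp C) (G.perp A) (rhom (G.perp A) C)).hom ≫
    G.perp C ◁ rev (G.perp A) C ≫ G.perpEval C)

/-- The 2-cell from `A^⊥ ⊗ (A ⟜ C^⊥)` to `C^⊥⊥` which corresponds, up to `θ`, to the composite of
evaluations from `(A^⊥ ⊗ (A ⟜ C^⊥)) ⊗ C^⊥` to `A^⊥ ⊗ A` and on to `D_Y`. -/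
def perpLhomEval (A : X ⟶ Y) (C : Y ⟶ Z) :
    G.perp A ≫ lhom A (G.perp C) ⟶ G.perp (G.perp C) :=
  lcurry ((α_ (G.perp A) (lhom A (G.perp C)) (G.perp C)).hom ≫
    G.perp A ◁ lev A (G.perp C) ≫ G.perpEval A) ≫ (G.θ (G.perp C)).hom

/-- The 2-cell from `A ⟜ C^⊥` to `A ⊕ C` which corresponds to the composite from
`(C^⊥ ⊗ A^⊥) ⊗ (A ⟜ C^⊥)` to `C^⊥ ⊗ C^⊥⊥` and on to `D_Z`. -/
def fromLhom (A : X ⟶ Y) (C : Y ⟶ Z) :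
    lhom A (G.perp C) ⟶ G.oplusComposition.oplus A C :=
  rcurry ((α_ (G.perp C) (G.perp A) (lhom A (G.perp C))).hom ≫
    G.perp C ◁ G.perpLhomEval A C ≫ rev (G.perp C) (G.D Z))

/-- The 2-cell from `(A ⊗ C)^⊥ ⊗ A` to `C^⊥`: the canonical 2-cell from `(A ⊗ C)^⊥` to `C^⊥ ⟜ A`,
followed by the evaluation of `C^⊥ ⟜ A`. -/
def evalL (A : X ⟶ Y) (C : Y ⟶ Z) : G.perp (A ≫ C) ≫ A ⟶ G.perp C :=
  lcurry ((α_ (G.perp (A ≫ C)) A C).hom ≫ G.perpEval (A ≫ C)) ≫ (G.θ C).hom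

/-- The 2-cell from `C ⊗ (A ⊗ C)^⊥` to `A^⊥`: the canonical 2-cell from `(A ⊗ C)^⊥` to `C ⊸ A^⊥`,
followed by the evaluation of `C ⊸ A^⊥`. -/
def evalR (A : X ⟶ Y) (C : Y ⟶ Z) : C ≫ G.perp (A ≫ C) ⟶ G.perp A :=
  rcurry ((α_ A C (G.perp (A ≫ C))).inv ≫ rev (A ≫ C) (G.D X))

/-- The 2-cell from `A ⊗ (C^⊥ ⊸ E)` to `(A ⊗ C)^⊥ ⊸ E` which corresponds to the composite of
evaluations from `((A ⊗ C)^⊥ ⊗ A) ⊗ (C^⊥ ⊸ E)` to `C^⊥ ⊗ (C^⊥ ⊸ E)` and on to `E`. -/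
def rhomDist (A : W ⟶ X) (C : X ⟶ Y) (E : Y ⟶ Z) :
    A ≫ rhom (G.perp C) E ⟶ rhom (G.perp (A ≫ C)) E :=
  rcurry ((α_ (G.perp (A ≫ C)) A (rhom (G.perp C) E)).inv ≫
    G.evalL A C ▷ rhom (G.perp C) E ≫ rev (G.perp C) E)

/-- The 2-cell from `(A ⟜ C^⊥) ⊗ E` to `A ⟜ (C ⊗ E)^⊥` which corresponds to the composite of
evaluations from `(A ⟜ C^⊥) ⊗ (E ⊗ (C ⊗ E)^⊥)` to `(A ⟜ C^⊥) ⊗ C^⊥` and on to `A`. -/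
def lhomDist (A : W ⟶ X) (C : X ⟶ Y) (E : Y ⟶ Z) :
    lhom A (G.perp C) ≫ E ⟶ lhom A (G.perp (C ≫ E)) :=
  lcurry ((α_ (lhom A (G.perp C)) E (G.perp (C ≫ E))).hom ≫
    lhom A (G.perp C) ◁ G.evalR C E ≫ lev A (G.perp C))

end CyclicDualizingFamily

end GirardBicat

/-! A dual `A^⊥` carries two pairings, `evalPerp : A ⊗ A^⊥ → D` and, through `θ`, `perpEval : A^⊥ ⊗
A → D`. Both are universal in `A^⊥`, by the closed structure. The dualizing hypothesis makes `A →
A^⊥⊥` invertible, and cyclicity says that this isomorphism turns each pairing for `A^⊥` into the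
other pairing for `A` (`toPerpPerp_evalPerp`, `toPerpPerp_perpEval`). Hence 2-cells into `A` are
also determined by pairing with `A^⊥`, on either side.

Consequently `A ⊕ C` has two evaluations, `parL : A^⊥ ⊗ (A ⊕ C) → C` and `parR : (A ⊕ C) ⊗ C^⊥ → A`,
which agree once paired down to `D` (`parR_perpEval`). Each is universal: `A ⊕ C` is both `A^⊥ ⊸ C`,
by `m`, and `A ⟜ C^⊥`, by `n`. Every structure 2-cell is defined by its effect under these
evaluations, and every law is checked after applying them. Both bracketings of a triple sum
represent 2-cells `A^⊥ ⊗ P ⊗ E^⊥ → C`, which gives the associator; `δ^L` is `parR` under `A ⊗ -`,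
and `δ^R` is `parL` under `- ⊗ E`.

The units need care. The pairings on `𝟙 ⊗ 𝟙^⊥` and `𝟙^⊥ ⊗ 𝟙` give two comparisons of `𝟙^⊥` with `D`,
which need not agree: for finite-dimensional vector spaces, `-θ` satisfies the hypotheses whenever
`θ` does, and changes the sign of only one of them. The right unitor therefore uses a corrected
isomorphism `𝟙 ≅ 𝟙^⊥⊥`, so that both unitors refer to the same comparison, as the triangle law
requires. -/

namespace GirardBicat

namespace CyclicDualizingFamily

variable {B : Type u} [Bicategory.{w, v} B] [Biclosed B] (G : CyclicDualizingFamily B)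
  {W X Y Z : B}

/-! ### The two evaluations of a dual -/

/-- The evaluation from `A ⊗ A^⊥` to `D_X`. -/
def evalPerp (A : X ⟶ Y) : A ≫ G.perp A ⟶ G.D X := rev A (G.D X)

theorem whiskerLeft_perpMap_evalPerp {A A' : X ⟶ Y} (f : A ⟶ A') :
    A ◁ G.perpMap f ≫ G.evalPerp A = f ▷ G.perp A' ≫ G.evalPerp A' :=
  rcurry_rev _

/-- The invertible 2-cell `θ_A`, as a 2-cell to `A^⊥`. -/
def lhomIsoPerp (A : X ⟶ Y) : lhom (G.D Y) A ≅ G.perp A := G.θ A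

theorem lhomMap_lhomIsoPerp {A A' : X ⟶ Y} (f : A ⟶ A') :
    lhomMap (G.D Y) f ≫ (G.lhomIsoPerp A).hom = (G.lhomIsoPerp A').hom ≫ G.perpMap f :=
  G.θ_naturality f

theorem perpEval_eq (A : X ⟶ Y) :
    G.perpEval A = (G.lhomIsoPerp A).inv ▷ A ≫ lev (G.D Y) A := rfl

/-- `perpMap` comes from the right hom; naturality of `θ` makes it compatible with the left-hom
evaluation too. -/
theorem perpMap_whiskerRight_perpEval {A A' : X ⟶ Y} (f : A ⟶ A') :
    G.perpMap f ▷ A ≫ G.perpEval A = G.perp A' ◁ f ≫ G.perpEval A' := by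
  have h : lhomMap (G.D Y) f ▷ A ≫ lev (G.D Y) A = lhom (G.D Y) A' ◁ f ≫ lev (G.D Y) A' :=
    lcurry_lev _
  have h' : G.perpMap f ≫ (G.lhomIsoPerp A).inv =
      (G.lhomIsoPerp A').inv ≫ lhomMap (G.D Y) f := by
    rw [Iso.comp_inv_eq, Category.assoc, lhomMap_lhomIsoPerp, Iso.inv_hom_id_assoc]
  rw [perpEval_eq, perpEval_eq, ← comp_whiskerRight_assoc, h', comp_whiskerRight_assoc,
    h, whisker_exchange_assoc]

/-- The 2-cell from `P` to `A^⊥` that corresponds to a 2-cell from `P ⊗ A` to `D_Y`. -/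
def perpLift {A : X ⟶ Y} {P : Y ⟶ X} (f : P ≫ A ⟶ G.D Y) : P ⟶ G.perp A :=
  lcurry f ≫ (G.lhomIsoPerp A).hom

theorem perpLift_perpEval {A : X ⟶ Y} {P : Y ⟶ X} (f : P ≫ A ⟶ G.D Y) :
    G.perpLift f ▷ A ≫ G.perpEval A = f := by
  rw [perpLift, perpEval_eq, ← comp_whiskerRight_assoc, Category.assoc, Iso.hom_inv_id,
    Category.comp_id, lcurry_lev]

/-- The 2-cell from `P` to `A^⊥` that corresponds to a 2-cell from `A ⊗ P` to `D_X`. -/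
def perpCurry {A : X ⟶ Y} {P : Y ⟶ X} (f : A ≫ P ⟶ G.D X) : P ⟶ G.perp A := rcurry f

theorem perpCurry_evalPerp {A : X ⟶ Y} {P : Y ⟶ X} (f : A ≫ P ⟶ G.D X) :
    A ◁ G.perpCurry f ≫ G.evalPerp A = f :=
  rcurry_rev f

theorem perp_ext {A : X ⟶ Y} {P : Y ⟶ X} {f g : P ⟶ G.perp A}
    (h : A ◁ f ≫ G.evalPerp A = A ◁ g ≫ G.evalPerp A) : f = g :=
  rhom_ext h

/-! ### The double dual -/

/-- The canonical 2-cell from `A` to its double dual. -/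
def toPerpPerp (A : X ⟶ Y) : A ⟶ G.perp (G.perp A) := G.perpCurry (G.perpEval A)

theorem toPerpPerp_evalPerp (A : X ⟶ Y) :
    G.perp A ◁ G.toPerpPerp A ≫ G.evalPerp (G.perp A) = G.perpEval A :=
  rcurry_rev _

/-- The canonical 2-cell from `A` to `(D_Y ⟜ A)^⊥`. -/
def toPerpLhom (A : X ⟶ Y) : A ⟶ G.perp (lhom (G.D Y) A) := toRhomLhom G.D A

instance (A : X ⟶ Y) : IsIso (G.toPerpLhom A) := G.dualizing A

theorem toPerpLhom_evalPerp (A : X ⟶ Y) :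
    lhom (G.D Y) A ◁ G.toPerpLhom A ≫ G.evalPerp (lhom (G.D Y) A) = lev (G.D Y) A :=
  rcurry_rev _

/-- The dualizing hypothesis concerns `D ⟜ A` rather than `A^⊥`; this factorization carries its
invertibility across `θ`. -/
theorem toPerpPerp_eq (A : X ⟶ Y) :
    G.toPerpPerp A = G.toPerpLhom A ≫ G.perpMap (G.lhomIsoPerp A).inv := by
  apply G.perp_ext
  rw [toPerpPerp_evalPerp, whiskerLeft_comp, Category.assoc, whiskerLeft_perpMap_evalPerp,
    whisker_exchange_assoc, toPerpLhom_evalPerp, perpEval_eq]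

theorem perpMap_id (A : X ⟶ Y) : G.perpMap (𝟙 A) = 𝟙 (G.perp A) := by
  apply G.perp_ext
  rw [whiskerLeft_perpMap_evalPerp]
  simp

theorem perpMap_comp {A A' A'' : X ⟶ Y} (f : A ⟶ A') (g : A' ⟶ A'') :
    G.perpMap (f ≫ g) = G.perpMap g ≫ G.perpMap f := by
  apply G.perp_ext
  rw [whiskerLeft_perpMap_evalPerp, whiskerLeft_comp, Category.assoc,
    whiskerLeft_perpMap_evalPerp, whisker_exchange_assoc, whiskerLeft_perpMap_evalPerp,
    comp_whiskerRight_assoc]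

instance {A A' : X ⟶ Y} (f : A ⟶ A') [IsIso f] : IsIso (G.perpMap f) :=
  ⟨G.perpMap (inv f), by rw [← perpMap_comp, IsIso.inv_hom_id, perpMap_id],
    by rw [← perpMap_comp, IsIso.hom_inv_id, perpMap_id]⟩

instance (A : X ⟶ Y) : IsIso (G.toPerpPerp A) := by
  rw [toPerpPerp_eq]
  infer_instance

/-- This is where cyclicity enters; naturality of `θ` cancels the two occurrences of `θ_A`. -/
theorem toPerpPerp_eq_perpLift (A : X ⟶ Y) : G.toPerpPerp A = G.perpLift (G.evalPerp A) := by
  have h : lcurry (G.evalPerp A) ≫ lhomMap (G.D X) (G.lhomIsoPerp A).hom ≫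
      (G.lhomIsoPerp (lhom (G.D Y) A)).hom = G.toPerpLhom A := G.cyclic A
  rw [toPerpPerp_eq, ← h, lhomMap_lhomIsoPerp, Category.assoc, Category.assoc, ← perpMap_comp,
    Iso.inv_hom_id, perpMap_id, Category.comp_id, perpLift]

theorem toPerpPerp_perpEval (A : X ⟶ Y) :
    G.toPerpPerp A ▷ G.perp A ≫ G.perpEval (G.perp A) = G.evalPerp A := by
  rw [toPerpPerp_eq_perpLift, perpLift_perpEval]

theorem inv_toPerpPerp_perpEval (A : X ⟶ Y) :
    G.perp A ◁ inv (G.toPerpPerp A) ≫ G.perpEval A = G.evalPerp (G.perp A) := by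
  rw [← toPerpPerp_evalPerp, ← whiskerLeft_comp_assoc]
  simp

theorem inv_toPerpPerp_evalPerp (A : X ⟶ Y) :
    inv (G.toPerpPerp A) ▷ G.perp A ≫ G.evalPerp A = G.perpEval (G.perp A) := by
  rw [← toPerpPerp_perpEval, ← comp_whiskerRight_assoc]
  simp

/-- Nondegeneracy in the variable `A` rather than its dual: reflexivity reduces it to the universal
property of `A^⊥⊥`. -/
theorem perpEval_ext {A P : X ⟶ Y} {f g : P ⟶ A}
    (h : G.perp A ◁ f ≫ G.perpEval A = G.perp A ◁ g ≫ G.perpEval A) : f = g := by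
  rw [← cancel_mono (G.toPerpPerp A)]
  apply G.perp_ext
  simpa only [whiskerLeft_comp, Category.assoc, toPerpPerp_evalPerp] using h

theorem perp_ext' {A : X ⟶ Y} {P : Y ⟶ X} {f g : P ⟶ G.perp A}
    (h : f ▷ A ≫ G.perpEval A = g ▷ A ≫ G.perpEval A) : f = g := by
  rw [← cancel_mono (G.lhomIsoPerp A).inv]
  apply lhom_ext
  simpa only [comp_whiskerRight, Category.assoc, perpEval_eq] using h

theorem evalPerp_ext {A P : X ⟶ Y} {f g : P ⟶ A}
    (h : f ▷ G.perp A ≫ G.evalPerp A = g ▷ G.perp A ≫ G.evalPerp A) : f = g := by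
  rw [← cancel_mono (G.toPerpPerp A)]
  apply G.perp_ext'
  simpa only [comp_whiskerRight, Category.assoc, toPerpPerp_perpEval] using h

/-- The 2-cell from `P` to `A` that corresponds to a 2-cell from `A^⊥ ⊗ P` to `D_Y`. -/
noncomputable def unperp {A P : X ⟶ Y} (f : G.perp A ≫ P ⟶ G.D Y) : P ⟶ A :=
  G.perpCurry f ≫ inv (G.toPerpPerp A)

theorem unperp_perpEval {A P : X ⟶ Y} (f : G.perp A ≫ P ⟶ G.D Y) :
    G.perp A ◁ G.unperp f ≫ G.perpEval A = f := by
  rw [unperp, whiskerLeft_comp, Category.assoc, inv_toPerpPerp_perpEval,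
    perpCurry_evalPerp]

/-! ### The two evaluations of `A ⊕ C` -/

/-- The evaluation from `(C^⊥ ⊗ A^⊥) ⊗ (A ⊕ C)` to `D_Z`. -/
def evalPar (A : X ⟶ Y) (C : Y ⟶ Z) :
    (G.perp C ≫ G.perp A) ≫ G.oplusComposition.oplus A C ⟶ G.D Z :=
  G.evalPerp (G.perp C ≫ G.perp A)

/-- The evaluation from `A^⊥ ⊗ (A ⊕ C)` to `C`. -/
noncomputable def parL (A : X ⟶ Y) (C : Y ⟶ Z) :
    G.perp A ≫ G.oplusComposition.oplus A C ⟶ C :=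
  G.unperp ((α_ _ _ _).inv ≫ G.evalPar A C)

/-- The evaluation from `(A ⊕ C) ⊗ C^⊥` to `A`. -/
noncomputable def parR (A : X ⟶ Y) (C : Y ⟶ Z) :
    G.oplusComposition.oplus A C ≫ G.perp C ⟶ A :=
  G.unperp ((α_ _ _ _).inv ≫ G.parL A C ▷ G.perp C ≫ G.evalPerp C)

theorem parL_perpEval (A : X ⟶ Y) (C : Y ⟶ Z) :
    G.perp C ◁ G.parL A C ≫ G.perpEval C =
      (α_ _ _ _).inv ≫ G.evalPar A C :=
  G.unperp_perpEval _

/-- The two evaluations of `A ⊕ C` induce the same 2-cell from `A^⊥ ⊗ (A ⊕ C) ⊗ C^⊥` to `D_Y`. -/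
theorem parR_perpEval (A : X ⟶ Y) (C : Y ⟶ Z) :
    G.perp A ◁ G.parR A C ≫ G.perpEval A =
      (α_ _ _ _).inv ≫ G.parL A C ▷ G.perp C ≫ G.evalPerp C :=
  G.unperp_perpEval _

theorem parL_evalPerp (A : X ⟶ Y) (C : Y ⟶ Z) :
    G.parL A C ▷ G.perp C ≫ G.evalPerp C =
      (α_ _ _ _).hom ≫ G.perp A ◁ G.parR A C ≫ G.perpEval A := by
  rw [parR_perpEval, Iso.hom_inv_id_assoc]

/-- Since `m` matches the universal evaluation of `A^⊥ ⊸ C` with `parL`, transposes along `parL` can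
be built from `rcurry`. -/
theorem fromRhom_parL (A : X ⟶ Y) (C : Y ⟶ Z) :
    G.perp A ◁ G.fromRhom A C ≫ G.parL A C = rev (G.perp A) C := by
  apply G.perpEval_ext
  have h : (G.perp C ≫ G.perp A) ◁ G.fromRhom A C ≫ G.evalPar A C =
      (α_ (G.perp C) (G.perp A) (rhom (G.perp A) C)).hom ≫
        G.perp C ◁ rev (G.perp A) C ≫ G.perpEval C := rcurry_rev _
  rw [whiskerLeft_comp, Category.assoc, parL_perpEval, associator_inv_naturality_right_assoc, h,
    Iso.inv_hom_id_assoc]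

theorem parL_ext {A : X ⟶ Y} {C : Y ⟶ Z} {P : X ⟶ Z} {f g : P ⟶ G.oplusComposition.oplus A C}
    (h : G.perp A ◁ f ≫ G.parL A C = G.perp A ◁ g ≫ G.parL A C) : f = g := by
  apply G.perp_ext
  have key (k : P ⟶ G.oplusComposition.oplus A C) :
      (G.perp C ≫ G.perp A) ◁ k ≫ G.evalPar A C =
        (α_ _ _ _).hom ≫ G.perp C ◁ (G.perp A ◁ k ≫ G.parL A C) ≫ G.perpEval C := by
    rw [whiskerLeft_comp, Category.assoc, parL_perpEval, associator_inv_naturality_right_assoc,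
      Iso.hom_inv_id_assoc]
  -- The goal mentions `perp` and `evalPerp` where `key` has `oplus` and `evalPar`; these agree by
  -- unfolding, so terms are chained instead of rewritten.
  exact (key f).trans ((by rw [h] : _ = _).trans (key g).symm)

/-- Pairing `parL` with `C^⊥` is the same as pairing `parR` with `A^⊥`, so uniqueness passes from
one evaluation to the other. -/
theorem parR_ext {A : X ⟶ Y} {C : Y ⟶ Z} {P : X ⟶ Z} {f g : P ⟶ G.oplusComposition.oplus A C}
    (h : f ▷ G.perp C ≫ G.parR A C = g ▷ G.perp C ≫ G.parR A C) : f = g := by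
  apply G.parL_ext
  apply G.evalPerp_ext
  have key (k : P ⟶ G.oplusComposition.oplus A C) :
      (G.perp A ◁ k ≫ G.parL A C) ▷ G.perp C ≫ G.evalPerp C =
        (α_ _ _ _).hom ≫ G.perp A ◁ (k ▷ G.perp C ≫ G.parR A C) ≫ G.perpEval A := by
    rw [comp_whiskerRight, Category.assoc, parL_evalPerp, whiskerLeft_comp, Category.assoc,
      associator_naturality_middle_assoc]
  rw [key, key, h]

theorem fromLhom_parL (A : X ⟶ Y) (C : Y ⟶ Z) :
    G.perp A ◁ G.fromLhom A C ≫ G.parL A C =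
      G.perpLhomEval A C ≫ inv (G.toPerpPerp C) := by
  apply G.perpEval_ext
  have h : (G.perp C ≫ G.perp A) ◁ G.fromLhom A C ≫ G.evalPar A C =
      (α_ (G.perp C) (G.perp A) (lhom A (G.perp C))).hom ≫
        G.perp C ◁ G.perpLhomEval A C ≫ G.evalPerp (G.perp C) := rcurry_rev _
  rw [whiskerLeft_comp, Category.assoc, parL_perpEval, associator_inv_naturality_right_assoc, h,
    Iso.inv_hom_id_assoc, whiskerLeft_comp, Category.assoc, inv_toPerpPerp_perpEval]

theorem fromLhom_parR (A : X ⟶ Y) (C : Y ⟶ Z) :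
    G.fromLhom A C ▷ G.perp C ≫ G.parR A C = lev A (G.perp C) := by
  apply G.perpEval_ext
  have h : G.perpLhomEval A C ▷ G.perp C ≫ G.perpEval (G.perp C) =
      (α_ (G.perp A) (lhom A (G.perp C)) (G.perp C)).hom ≫
        G.perp A ◁ lev A (G.perp C) ≫ G.perpEval A := G.perpLift_perpEval _
  rw [whiskerLeft_comp, Category.assoc, parR_perpEval, associator_inv_naturality_middle_assoc,
    ← comp_whiskerRight_assoc, fromLhom_parL, comp_whiskerRight_assoc, inv_toPerpPerp_evalPerp, h,
    Iso.inv_hom_id_assoc]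

instance isIso_fromRhom (A : X ⟶ Y) (C : Y ⟶ Z) : IsIso (G.fromRhom A C) := by
  refine ⟨rcurry (G.parL A C), rhom_ext ?_, G.parL_ext ?_⟩
  · rw [whiskerLeft_comp, Category.assoc, rcurry_rev, fromRhom_parL, whiskerLeft_id,
      Category.id_comp]
  · rw [whiskerLeft_comp, Category.assoc, fromRhom_parL, rcurry_rev, whiskerLeft_id,
      Category.id_comp]

instance isIso_fromLhom (A : X ⟶ Y) (C : Y ⟶ Z) : IsIso (G.fromLhom A C) := by
  refine ⟨lcurry (G.parR A C), lhom_ext ?_, G.parR_ext ?_⟩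
  · rw [comp_whiskerRight, Category.assoc, lcurry_lev, fromLhom_parR, id_whiskerRight,
      Category.id_comp]
  · rw [comp_whiskerRight, Category.assoc, fromLhom_parR, lcurry_lev, id_whiskerRight,
      Category.id_comp]

/-- The 2-cell from `P` to `A ⊕ C` that corresponds to a 2-cell from `A^⊥ ⊗ P` to `C`. -/
def parLiftL {A : X ⟶ Y} {C : Y ⟶ Z} {P : X ⟶ Z} (f : G.perp A ≫ P ⟶ C) :
    P ⟶ G.oplusComposition.oplus A C :=
  rcurry f ≫ G.fromRhom A C

/-- The 2-cell from `P` to `A ⊕ C` that corresponds to a 2-cell from `P ⊗ C^⊥` to `A`. -/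
def parLiftR {A : X ⟶ Y} {C : Y ⟶ Z} {P : X ⟶ Z} (f : P ≫ G.perp C ⟶ A) :
    P ⟶ G.oplusComposition.oplus A C :=
  lcurry f ≫ G.fromLhom A C

theorem parLiftL_parL {A : X ⟶ Y} {C : Y ⟶ Z} {P : X ⟶ Z} (f : G.perp A ≫ P ⟶ C) :
    G.perp A ◁ G.parLiftL f ≫ G.parL A C = f := by
  rw [parLiftL, whiskerLeft_comp, Category.assoc, fromRhom_parL, rcurry_rev]

theorem parLiftR_parR {A : X ⟶ Y} {C : Y ⟶ Z} {P : X ⟶ Z} (f : P ≫ G.perp C ⟶ A) :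
    G.parLiftR f ▷ G.perp C ≫ G.parR A C = f := by
  rw [parLiftR, comp_whiskerRight, Category.assoc, fromLhom_parR, lcurry_lev]

/-! ### The action of `⊕` on 2-cells -/

/-- Each evaluation is natural in its target and dinatural in the dualized variable. The action of
`⊕` on 2-cells is used later only through these four rules. -/
theorem oplusLeft_parL (A : X ⟶ Y) {C C' : Y ⟶ Z} (g : C ⟶ C') :
    G.perp A ◁ G.oplusComposition.oplusLeft A g ≫ G.parL A C' = G.parL A C ≫ g := by
  apply G.perpEval_ext
  have h : (G.perp C' ≫ G.perp A) ◁ G.oplusComposition.oplusLeft A g ≫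
        G.evalPar A C' =
      (G.perpMap g ▷ G.perp A) ▷ G.oplusComposition.oplus A C ≫
        G.evalPar A C := G.whiskerLeft_perpMap_evalPerp _
  rw [whiskerLeft_comp, Category.assoc, parL_perpEval, associator_inv_naturality_right_assoc, h,
    whiskerLeft_comp, Category.assoc, ← perpMap_whiskerRight_perpEval, whisker_exchange_assoc,
    parL_perpEval, associator_inv_naturality_left_assoc]

theorem oplusRight_parL {A A' : X ⟶ Y} (f : A ⟶ A') (C : Y ⟶ Z) :
    G.perp A' ◁ G.oplusComposition.oplusRight f C ≫ G.parL A' C =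
      G.perpMap f ▷ G.oplusComposition.oplus A C ≫ G.parL A C := by
  apply G.perpEval_ext
  have h : (G.perp C ≫ G.perp A') ◁ G.oplusComposition.oplusRight f C ≫
        G.evalPar A' C =
      (G.perp C ◁ G.perpMap f) ▷ G.oplusComposition.oplus A C ≫
        G.evalPar A C := G.whiskerLeft_perpMap_evalPerp _
  rw [whiskerLeft_comp, Category.assoc, parL_perpEval, associator_inv_naturality_right_assoc, h,
    whiskerLeft_comp, Category.assoc, parL_perpEval, associator_inv_naturality_middle_assoc]

theorem oplusRight_parR {A A' : X ⟶ Y} (f : A ⟶ A') (C : Y ⟶ Z) :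
    G.oplusComposition.oplusRight f C ▷ G.perp C ≫ G.parR A' C = G.parR A C ≫ f := by
  apply G.perpEval_ext
  rw [whiskerLeft_comp, Category.assoc, parR_perpEval, associator_inv_naturality_middle_assoc,
    ← comp_whiskerRight_assoc, oplusRight_parL, whiskerLeft_comp, Category.assoc,
    ← perpMap_whiskerRight_perpEval, whisker_exchange_assoc, parR_perpEval,
    associator_inv_naturality_left_assoc, comp_whiskerRight_assoc]

theorem oplusLeft_parR (A : X ⟶ Y) {C C' : Y ⟶ Z} (g : C ⟶ C') :
    G.oplusComposition.oplusLeft A g ▷ G.perp C' ≫ G.parR A C' =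
      G.oplusComposition.oplus A C ◁ G.perpMap g ≫ G.parR A C := by
  apply G.perpEval_ext
  rw [whiskerLeft_comp, Category.assoc, parR_perpEval, associator_inv_naturality_middle_assoc,
    ← comp_whiskerRight_assoc, oplusLeft_parL, whiskerLeft_comp, Category.assoc,
    parR_perpEval, comp_whiskerRight_assoc, ← whiskerLeft_perpMap_evalPerp,
    associator_inv_naturality_right_assoc, whisker_exchange_assoc]

/-! ### The associator of `⊕` -/

/-- The 2-cell from `(A ⊕ C) ⊕ E` to `A ⊕ (C ⊕ E)`. -/
noncomputable def parAssocHom (A : W ⟶ X) (C : X ⟶ Y) (E : Y ⟶ Z) :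
    G.oplusComposition.oplus (G.oplusComposition.oplus A C) E ⟶
      G.oplusComposition.oplus A (G.oplusComposition.oplus C E) :=
  G.parLiftL (G.parLiftR ((α_ _ _ _).hom ≫
    G.perp A ◁ G.parR (G.oplusComposition.oplus A C) E ≫ G.parL A C))

/-- The 2-cell from `A ⊕ (C ⊕ E)` to `(A ⊕ C) ⊕ E`. -/
noncomputable def parAssocInv (A : W ⟶ X) (C : X ⟶ Y) (E : Y ⟶ Z) :
    G.oplusComposition.oplus A (G.oplusComposition.oplus C E) ⟶
      G.oplusComposition.oplus (G.oplusComposition.oplus A C) E :=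
  G.parLiftR (G.parLiftL ((α_ _ _ _).inv ≫
    G.parL A (G.oplusComposition.oplus C E) ▷ G.perp E ≫ G.parR C E))

/-- This equation characterizes the associator: the outer evaluations may be performed in either
order. -/
theorem parAssocHom_parL_parR (A : W ⟶ X) (C : X ⟶ Y) (E : Y ⟶ Z) :
    (G.perp A ◁ G.parAssocHom A C E ≫ G.parL A (G.oplusComposition.oplus C E)) ▷ G.perp E ≫
        G.parR C E =
      (α_ _ _ _).hom ≫ G.perp A ◁ G.parR (G.oplusComposition.oplus A C) E ≫ G.parL A C := by
  rw [parAssocHom, parLiftL_parL, parLiftR_parR]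

theorem parAssocInv_parR_parL (A : W ⟶ X) (C : X ⟶ Y) (E : Y ⟶ Z) :
    G.perp A ◁ (G.parAssocInv A C E ▷ G.perp E ≫ G.parR (G.oplusComposition.oplus A C) E) ≫
        G.parL A C =
      (α_ _ _ _).inv ≫ G.parL A (G.oplusComposition.oplus C E) ▷ G.perp E ≫ G.parR C E := by
  rw [parAssocInv, parLiftR_parR, parLiftL_parL]

theorem comp_parAssocHom_parL_parR {A : W ⟶ X} {C : X ⟶ Y} {E : Y ⟶ Z} {P : W ⟶ Z}
    (k : P ⟶ G.oplusComposition.oplus (G.oplusComposition.oplus A C) E) :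
    (G.perp A ◁ (k ≫ G.parAssocHom A C E) ≫
        G.parL A (G.oplusComposition.oplus C E)) ▷ G.perp E ≫ G.parR C E =
      (α_ _ _ _).hom ≫ G.perp A ◁ (k ▷ G.perp E ≫ G.parR (G.oplusComposition.oplus A C) E) ≫
        G.parL A C := by
  rw [whiskerLeft_comp, Category.assoc, comp_whiskerRight, Category.assoc,
    parAssocHom_parL_parR, whiskerLeft_comp, Category.assoc, associator_naturality_middle_assoc]

theorem parL_parR_ext {A : W ⟶ X} {C : X ⟶ Y} {E : Y ⟶ Z} {P : W ⟶ Z}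
    {f g : P ⟶ G.oplusComposition.oplus A (G.oplusComposition.oplus C E)}
    (h : (G.perp A ◁ f ≫ G.parL A (G.oplusComposition.oplus C E)) ▷ G.perp E ≫ G.parR C E =
      (G.perp A ◁ g ≫ G.parL A (G.oplusComposition.oplus C E)) ▷ G.perp E ≫ G.parR C E) :
    f = g :=
  G.parL_ext (G.parR_ext h)

theorem parR_parL_ext {A : W ⟶ X} {C : X ⟶ Y} {E : Y ⟶ Z} {P : W ⟶ Z}
    {f g : P ⟶ G.oplusComposition.oplus (G.oplusComposition.oplus A C) E}
    (h : G.perp A ◁ (f ▷ G.perp E ≫ G.parR (G.oplusComposition.oplus A C) E) ≫ G.parL A C =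
      G.perp A ◁ (g ▷ G.perp E ≫ G.parR (G.oplusComposition.oplus A C) E) ≫ G.parL A C) :
    f = g :=
  G.parR_ext (G.parL_ext h)

/-- The associator of `⊕`. -/
noncomputable def parAssoc (A : W ⟶ X) (C : X ⟶ Y) (E : Y ⟶ Z) :
    G.oplusComposition.oplus (G.oplusComposition.oplus A C) E ≅
      G.oplusComposition.oplus A (G.oplusComposition.oplus C E) where
  hom := G.parAssocHom A C E
  inv := G.parAssocInv A C E
  hom_inv_id := by
    apply G.parR_parL_ext
    rw [comp_whiskerRight, Category.assoc, whiskerLeft_comp, Category.assoc,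
      parAssocInv_parR_parL, associator_inv_naturality_middle_assoc, ← comp_whiskerRight_assoc,
      parAssocHom_parL_parR]
    simp
  inv_hom_id := by
    apply G.parL_parR_ext
    rw [comp_parAssocHom_parL_parR, parAssocInv_parR_parL]
    simp

theorem oplusLeft_oplus_parAssocHom (A : W ⟶ X) (C : X ⟶ Y) {E E' : Y ⟶ Z} (h : E ⟶ E') :
    G.oplusComposition.oplusLeft (G.oplusComposition.oplus A C) h ≫ G.parAssocHom A C E' =
      G.parAssocHom A C E ≫
        G.oplusComposition.oplusLeft A (G.oplusComposition.oplusLeft C h) := by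
  apply G.parL_parR_ext
  rw [comp_parAssocHom_parL_parR, oplusLeft_parR, whiskerLeft_comp (G.perp A), Category.assoc,
    whiskerLeft_comp (G.perp A), Category.assoc, oplusLeft_parL,
    ← Category.assoc (G.perp A ◁ G.parAssocHom A C E), comp_whiskerRight, Category.assoc,
    oplusLeft_parR, ← whisker_exchange_assoc, parAssocHom_parL_parR]
  simp

theorem oplusRight_oplus_parAssocHom {A A' : W ⟶ X} (f : A ⟶ A') (C : X ⟶ Y) (E : Y ⟶ Z) :
    G.oplusComposition.oplusRight (G.oplusComposition.oplusRight f C) E ≫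
        G.parAssocHom A' C E =
      G.parAssocHom A C E ≫
        G.oplusComposition.oplusRight f (G.oplusComposition.oplus C E) := by
  apply G.parL_parR_ext
  rw [comp_parAssocHom_parL_parR, oplusRight_parR, whiskerLeft_comp (G.perp A'), Category.assoc,
    whiskerLeft_comp (G.perp A'), Category.assoc, oplusRight_parL, oplusRight_parL,
    whisker_exchange_assoc, whisker_exchange_assoc, comp_whiskerRight, Category.assoc,
    parAssocHom_parL_parR, associator_naturality_left_assoc]

theorem oplusRight_oplusLeft_parAssocHom (A : W ⟶ X) {C C' : X ⟶ Y} (g : C ⟶ C') (E : Y ⟶ Z) :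
    G.oplusComposition.oplusRight (G.oplusComposition.oplusLeft A g) E ≫ G.parAssocHom A C' E =
      G.parAssocHom A C E ≫
        G.oplusComposition.oplusLeft A (G.oplusComposition.oplusRight g E) := by
  apply G.parL_parR_ext
  rw [comp_parAssocHom_parL_parR, oplusRight_parR, whiskerLeft_comp (G.perp A), Category.assoc,
    whiskerLeft_comp (G.perp A), Category.assoc, oplusLeft_parL, oplusLeft_parL,
    ← Category.assoc (G.perp A ◁ G.parAssocHom A C E), comp_whiskerRight, Category.assoc,
    oplusRight_parR, ← Category.assoc (_ ▷ G.perp E), parAssocHom_parL_parR]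
  simp only [Category.assoc]

/-- The 2-cell from `C^⊥ ⊗ A^⊥` to `(A ⊕ C)^⊥`. -/
def tensorPerp (A : X ⟶ Y) (C : Y ⟶ Z) :
    G.perp C ≫ G.perp A ⟶ G.perp (G.oplusComposition.oplus A C) :=
  G.perpLift (G.evalPar A C)

theorem tensorPerp_perpEval (A : X ⟶ Y) (C : Y ⟶ Z) :
    G.tensorPerp A C ▷ G.oplusComposition.oplus A C ≫
        G.perpEval (G.oplusComposition.oplus A C) =
      (α_ _ _ _).hom ≫ G.perp C ◁ G.parL A C ≫ G.perpEval C := by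
  rw [tensorPerp, perpLift_perpEval, parL_perpEval, Iso.hom_inv_id_assoc]

theorem parL_evalPerp_comp {A : X ⟶ Y} {C : Y ⟶ Z} {P : X ⟶ Z}
    (k : P ⟶ G.oplusComposition.oplus A C) :
    (G.perp A ◁ k ≫ G.parL A C) ▷ G.perp C ≫ G.evalPerp C =
      (α_ _ _ _).hom ≫ G.perp A ◁ (k ▷ G.perp C ≫ G.parR A C) ≫ G.perpEval A := by
  rw [comp_whiskerRight, Category.assoc, parL_evalPerp, whiskerLeft_comp, Category.assoc,
    associator_naturality_middle_assoc]

/-- The pentagon has an associator whose first argument is `A ⊕ C`, evaluated against `(A ⊕ C)^⊥`;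
`tensorPerp` replaces that by evaluation against `A^⊥` and then `C^⊥`. -/
theorem parAssocHom_parL_parL (A : W ⟶ X) (C : X ⟶ Y) (E : Y ⟶ Z) :
    G.perp C ◁ (G.perp A ◁ G.parAssocHom A C E ≫ G.parL A (G.oplusComposition.oplus C E)) ≫
        G.parL C E =
      (α_ _ _ _).inv ≫ G.tensorPerp A C ▷ _ ≫ G.parL (G.oplusComposition.oplus A C) E := by
  apply G.evalPerp_ext
  rw [parL_evalPerp_comp, parAssocHom_parL_parR, comp_whiskerRight, comp_whiskerRight,
    Category.assoc, Category.assoc, parL_evalPerp, associator_naturality_left_assoc,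
    ← whisker_exchange_assoc, tensorPerp_perpEval]
  simp

/-! ### The units of `⊕` -/

/-- The comparison of `𝟙^⊥` with `D_X` through the evaluation from `𝟙 ⊗ 𝟙^⊥`. -/
def botEval (X : B) : G.oplusComposition.bot X ⟶ G.D X := (λ_ _).inv ≫ G.evalPerp (𝟙 X)

/-- The comparison of `𝟙^⊥` with `D_X` through the evaluation from `𝟙^⊥ ⊗ 𝟙`. -/
def botEval' (X : B) : G.oplusComposition.bot X ⟶ G.D X := (ρ_ _).inv ≫ G.perpEval (𝟙 X)

theorem evalPerp_id (X : B) : G.evalPerp (𝟙 X) = (λ_ _).hom ≫ G.botEval X :=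
  (Iso.hom_inv_id_assoc _ _).symm

theorem perpEval_id (X : B) : G.perpEval (𝟙 X) = (ρ_ _).hom ≫ G.botEval' X :=
  (Iso.hom_inv_id_assoc _ _).symm

/-- The universal property of `𝟙 ⊸ D_X`, moved along the unitor; `exists_comp_botEval` supplies the
existence half. -/
theorem botEval_ext {X : B} {P : X ⟶ X} {f g : P ⟶ G.oplusComposition.bot X}
    (h : f ≫ G.botEval X = g ≫ G.botEval X) : f = g := by
  apply G.perp_ext
  rw [evalPerp_id]
  exact (leftUnitor_naturality_assoc f _).trans
    ((congrArg _ h).trans (leftUnitor_naturality_assoc g _).symm)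

theorem botEval'_ext {X : B} {P : X ⟶ X} {f g : P ⟶ G.oplusComposition.bot X}
    (h : f ≫ G.botEval' X = g ≫ G.botEval' X) : f = g := by
  apply G.perp_ext'
  rw [perpEval_id]
  exact (rightUnitor_naturality_assoc f _).trans
    ((congrArg _ h).trans (rightUnitor_naturality_assoc g _).symm)

theorem exists_comp_botEval {X : B} {P : X ⟶ X} (f : P ⟶ G.D X) :
    ∃ k : P ⟶ G.oplusComposition.bot X, k ≫ G.botEval X = f := by
  refine ⟨G.perpCurry ((λ_ _).hom ≫ f), ?_⟩
  have h := G.perpCurry_evalPerp (A := 𝟙 X) ((λ_ P).hom ≫ f)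
  rw [evalPerp_id] at h
  rw [← cancel_epi (λ_ P).hom]
  exact (leftUnitor_naturality_assoc _ _).symm.trans h

theorem exists_comp_botEval' {X : B} {P : X ⟶ X} (f : P ⟶ G.D X) :
    ∃ k : P ⟶ G.oplusComposition.bot X, k ≫ G.botEval' X = f := by
  refine ⟨G.perpLift ((ρ_ _).hom ≫ f), ?_⟩
  have h := G.perpLift_perpEval (A := 𝟙 X) ((ρ_ P).hom ≫ f)
  rw [perpEval_id] at h
  rw [← cancel_epi (ρ_ P).hom]
  exact (rightUnitor_naturality_assoc _ _).symm.trans h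

/-- The two comparisons of `𝟙^⊥` with `D_X` differ by an automorphism of `𝟙^⊥`. -/
theorem exists_botEval_eq (X : B) :
    ∃ φ : G.oplusComposition.bot X ≅ G.oplusComposition.bot X,
      φ.hom ≫ G.botEval' X = G.botEval X := by
  obtain ⟨φ, hφ⟩ := G.exists_comp_botEval' (G.botEval X)
  obtain ⟨ψ, hψ⟩ := G.exists_comp_botEval (G.botEval' X)
  refine ⟨⟨φ, ψ, G.botEval_ext ?_, G.botEval'_ext ?_⟩, hφ⟩
  · rw [Category.assoc, hψ, hφ, Category.id_comp]
  · rw [Category.assoc, hφ, hψ, Category.id_comp]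

/-- The canonical 2-cell from `𝟙` to `𝟙^⊥⊥`. -/
def toPerpBot (X : B) : 𝟙 X ⟶ G.perp (G.oplusComposition.bot X) := G.toPerpPerp (𝟙 X)

instance (X : B) : IsIso (G.toPerpBot X) := inferInstanceAs (IsIso (G.toPerpPerp (𝟙 X)))

/-- There is an isomorphism `𝟙 ≅ 𝟙^⊥⊥` that transposes the same 2-cell from `𝟙^⊥` to `D_X` as
the canonical one, but on the other side. -/
theorem exists_idIsoPerpBot (X : B) :
    ∃ u : 𝟙 X ≅ G.perp (G.oplusComposition.bot X),
      G.oplusComposition.bot X ◁ u.hom ≫ G.evalPerp (G.oplusComposition.bot X) =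
        (ρ_ _).hom ≫ G.botEval X := by
  obtain ⟨φ, hφ⟩ := G.exists_botEval_eq X
  have hη : G.oplusComposition.bot X ◁ G.toPerpBot X ≫
      G.evalPerp (G.oplusComposition.bot X) = G.perpEval (𝟙 X) := G.toPerpPerp_evalPerp _
  -- The canonical isomorphism yields `botEval'`; the dual of `φ` corrects it to `botEval`.
  refine ⟨asIso (G.toPerpBot X) ≪≫ asIso (G.perpMap φ.hom), ?_⟩
  rw [Iso.trans_hom, asIso_hom, asIso_hom, whiskerLeft_comp, Category.assoc,
    whiskerLeft_perpMap_evalPerp, whisker_exchange_assoc, hη, perpEval_id]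
  exact (rightUnitor_naturality_assoc _ _).trans (congrArg _ hφ)

/-- An isomorphism from `𝟙` to `𝟙^⊥⊥`, used in the right unitor of `⊕`. -/
noncomputable def idIsoPerpBot (X : B) : 𝟙 X ≅ G.perp (G.oplusComposition.bot X) :=
  (G.exists_idIsoPerpBot X).choose

theorem idIsoPerpBot_evalPerp (X : B) :
    G.oplusComposition.bot X ◁ (G.idIsoPerpBot X).hom ≫
        G.evalPerp (G.oplusComposition.bot X) =
      (ρ_ _).hom ≫ G.botEval X :=
  (G.exists_idIsoPerpBot X).choose_spec

/-- The canonical isomorphism from `𝟙` to `𝟙^⊥⊥`, used in the left unitor of `⊕`. -/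
noncomputable def idIsoPerpBot' (X : B) : 𝟙 X ≅ G.perp (G.oplusComposition.bot X) :=
  asIso (G.toPerpBot X)

theorem idIsoPerpBot'_perpEval (X : B) :
    (G.idIsoPerpBot' X).hom ▷ G.oplusComposition.bot X ≫
        G.perpEval (G.oplusComposition.bot X) =
      (λ_ _).hom ≫ G.botEval X :=
  (G.toPerpPerp_perpEval (𝟙 X)).trans (G.evalPerp_id X)

/-- The left unitor of `⊕`. -/
noncomputable def parLeftUnitor (A : X ⟶ Y) :
    G.oplusComposition.oplus (G.oplusComposition.bot X) A ≅ A where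
  hom := (λ_ _).inv ≫ (G.idIsoPerpBot' X).hom ▷ _ ≫ G.parL _ A
  inv := G.parLiftL ((G.idIsoPerpBot' X).inv ▷ A ≫ (λ_ A).hom)
  hom_inv_id := by
    apply G.parL_ext
    rw [whiskerLeft_comp, Category.assoc, parLiftL_parL, whisker_exchange_assoc]
    simp
  inv_hom_id := by
    rw [leftUnitor_inv_naturality_assoc, whisker_exchange_assoc, parLiftL_parL]
    simp

/-- The right unitor of `⊕`. -/
noncomputable def parRightUnitor (A : X ⟶ Y) :
    G.oplusComposition.oplus A (G.oplusComposition.bot Y) ≅ A where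
  hom := (ρ_ _).inv ≫ _ ◁ (G.idIsoPerpBot Y).hom ≫ G.parR A _
  inv := G.parLiftR (A ◁ (G.idIsoPerpBot Y).inv ≫ (ρ_ A).hom)
  hom_inv_id := by
    apply G.parR_ext
    rw [comp_whiskerRight, Category.assoc, parLiftR_parR, ← whisker_exchange_assoc]
    simp
  inv_hom_id := by
    rw [rightUnitor_inv_naturality_assoc, ← whisker_exchange_assoc, parLiftR_parR]
    simp

theorem parLeftUnitor_hom (A : X ⟶ Y) :
    (G.parLeftUnitor A).hom = (λ_ _).inv ≫ (G.idIsoPerpBot' X).hom ▷ _ ≫ G.parL _ A := rfl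

theorem parRightUnitor_hom (A : X ⟶ Y) :
    (G.parRightUnitor A).hom = (ρ_ _).inv ≫ _ ◁ (G.idIsoPerpBot Y).hom ≫ G.parR A _ := rfl

/-- Here and in `parRightUnitor_perpEval` the same `botEval` appears, which is what makes the
triangle law hold. -/
theorem parLeftUnitor_evalPerp (A : X ⟶ Y) :
    (G.parLeftUnitor A).hom ▷ G.perp A ≫ G.evalPerp A =
      G.parR (G.oplusComposition.bot X) A ≫ G.botEval X := by
  rw [parLeftUnitor_hom, comp_whiskerRight, comp_whiskerRight, Category.assoc, Category.assoc,
    parL_evalPerp, associator_naturality_left_assoc, ← whisker_exchange_assoc,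
    idIsoPerpBot'_perpEval, leftUnitor_naturality_assoc]
  simp

theorem parRightUnitor_perpEval (A : X ⟶ Y) :
    G.perp A ◁ (G.parRightUnitor A).hom ≫ G.perpEval A =
      G.parL A (G.oplusComposition.bot Y) ≫ G.botEval Y := by
  rw [parRightUnitor_hom, whiskerLeft_comp, whiskerLeft_comp, Category.assoc, Category.assoc,
    parR_perpEval, associator_inv_naturality_right_assoc, whisker_exchange_assoc,
    idIsoPerpBot_evalPerp, rightUnitor_naturality_assoc]
  simp

/-- `⊕` is the composition of a second bicategory structure. -/
noncomputable def secondBicategory : SecondBicategory G.oplusComposition where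
  assoc := G.parAssoc
  leftUnit := G.parLeftUnitor
  rightUnit := G.parRightUnitor
  oplusLeft_id A C := G.parL_ext (by rw [oplusLeft_parL]; simp)
  oplusLeft_comp A _ _ _ g g' := G.parL_ext (by
    rw [oplusLeft_parL, whiskerLeft_comp, Category.assoc, oplusLeft_parL,
      reassoc_of% G.oplusLeft_parL])
  bot_oplusLeft f := by
    rw [← Category.assoc, Iso.eq_comp_inv, parLeftUnitor_hom, parLeftUnitor_hom,
      leftUnitor_inv_naturality_assoc, whisker_exchange_assoc, oplusLeft_parL]
    simp only [Category.assoc]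
  comp_oplusLeft A C _ _ h := by
    rw [← Category.assoc, Iso.eq_comp_inv]
    exact G.oplusLeft_oplus_parAssocHom A C h
  id_oplusRight A C := G.parR_ext (by rw [oplusRight_parR]; simp)
  comp_oplusRight f f' C := G.parR_ext (by
    rw [oplusRight_parR, comp_whiskerRight, Category.assoc, oplusRight_parR,
      reassoc_of% G.oplusRight_parR])
  oplusRight_bot f := by
    rw [← Category.assoc, Iso.eq_comp_inv, parRightUnitor_hom, parRightUnitor_hom,
      rightUnitor_inv_naturality_assoc, ← whisker_exchange_assoc, oplusRight_parR]
    simp only [Category.assoc]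
  oplusRight_comp f C E := by
    rw [Iso.eq_inv_comp]
    exact (G.oplusRight_oplus_parAssocHom f C E).symm
  oplus_assoc A _ _ g E := by
    rw [← Category.assoc, Iso.eq_comp_inv]
    exact G.oplusRight_oplusLeft_parAssocHom A g E
  oplus_exchange f g := G.parL_ext (by
    rw [whiskerLeft_comp, Category.assoc, oplusRight_parL, whisker_exchange_assoc,
      oplusLeft_parL, whiskerLeft_comp, Category.assoc, oplusLeft_parL, ← Category.assoc,
      ← Category.assoc, oplusRight_parL])
  pentagon A C E F := by
    change G.oplusComposition.oplusRight (G.parAssocHom A C E) F ≫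
        G.parAssocHom A (G.oplusComposition.oplus C E) F ≫
          G.oplusComposition.oplusLeft A (G.parAssocHom C E F) =
      G.parAssocHom (G.oplusComposition.oplus A C) E F ≫
        G.parAssocHom A C (G.oplusComposition.oplus E F)
    -- Stripping `A` and `C` on the left and `F` on the right leaves 2-cells into `E`.
    apply G.parL_ext
    apply G.parL_parR_ext
    have hR : (G.perp C ◁ (G.perp A ◁ (G.parAssocHom (G.oplusComposition.oplus A C) E F ≫
          G.parAssocHom A C (G.oplusComposition.oplus E F)) ≫ G.parL A _) ≫
            G.parL C _) ▷ G.perp F ≫ G.parR E F =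
        (α_ _ _ _).inv ▷ G.perp F ≫ (α_ _ _ _).hom ≫ G.tensorPerp A C ▷ _ ≫
          G.perp _ ◁ G.parR _ F ≫ G.parL _ E := by
      rw [whiskerLeft_comp (G.perp A), Category.assoc, whiskerLeft_comp (G.perp C),
        Category.assoc, parAssocHom_parL_parL, associator_inv_naturality_right_assoc,
        whisker_exchange_assoc, comp_whiskerRight, Category.assoc,
        comp_whiskerRight (G.tensorPerp A C ▷ _), Category.assoc, parAssocHom_parL_parR,
        associator_naturality_left_assoc]
    rw [hR, ← Category.assoc (G.oplusComposition.oplusRight _ F),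
      whiskerLeft_comp (G.perp A), Category.assoc, oplusLeft_parL, ← Category.assoc (G.perp A ◁ _),
      comp_parAssocHom_parL_parR, comp_parAssocHom_parL_parR, oplusRight_parR,
      whiskerLeft_comp (G.perp A), Category.assoc, whiskerLeft_comp (G.perp C),
      whiskerLeft_comp (G.perp C) (G.perp A ◁ _), Category.assoc, Category.assoc,
      parAssocHom_parL_parL, ← whisker_exchange_assoc]
    simp
  triangle A C := by
    change G.parAssocHom A (G.oplusComposition.bot _) C ≫
      G.oplusComposition.oplusLeft A (G.parLeftUnitor C).hom =
        G.oplusComposition.oplusRight (G.parRightUnitor A).hom C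
    -- After stripping `A` and pairing with `C^⊥`, both unitors become evaluations followed by
    -- `botEval`, and the associator rule identifies them.
    apply G.parL_ext
    apply G.evalPerp_ext
    rw [G.parL_evalPerp_comp (G.oplusComposition.oplusRight _ C), oplusRight_parR,
      whiskerLeft_comp (G.perp A) (G.parR _ _), Category.assoc, parRightUnitor_perpEval,
      whiskerLeft_comp, Category.assoc, oplusLeft_parL,
      ← Category.assoc, comp_whiskerRight, Category.assoc, parLeftUnitor_evalPerp,
      ← Category.assoc, parAssocHom_parL_parR]
    simp only [Category.assoc]

/-! ### The linear distributions -/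

theorem evalL_perpEval (A : X ⟶ Y) (C : Y ⟶ Z) :
    G.evalL A C ▷ C ≫ G.perpEval C = (α_ _ _ _).hom ≫ G.perpEval (A ≫ C) :=
  G.perpLift_perpEval _

theorem evalR_evalPerp (A : X ⟶ Y) (C : Y ⟶ Z) :
    A ◁ G.evalR A C ≫ G.evalPerp A = (α_ _ _ _).inv ≫ G.evalPerp (A ≫ C) :=
  G.perpCurry_evalPerp _

/-- The linear distribution from `A ⊗ (C ⊕ E)` to `(A ⊗ C) ⊕ E`. -/
noncomputable def distL (A : W ⟶ X) (C : X ⟶ Y) (E : Y ⟶ Z) :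
    A ≫ G.oplusComposition.oplus C E ⟶ G.oplusComposition.oplus (A ≫ C) E :=
  G.parLiftR ((α_ _ _ _).hom ≫ A ◁ G.parR C E)

/-- The linear distribution from `(A ⊕ C) ⊗ E` to `A ⊕ (C ⊗ E)`. -/
noncomputable def distR (A : W ⟶ X) (C : X ⟶ Y) (E : Y ⟶ Z) :
    G.oplusComposition.oplus A C ≫ E ⟶ G.oplusComposition.oplus A (C ≫ E) :=
  G.parLiftL ((α_ _ _ _).inv ≫ G.parL A C ▷ E)

theorem distL_parR (A : W ⟶ X) (C : X ⟶ Y) (E : Y ⟶ Z) :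
    G.distL A C E ▷ G.perp E ≫ G.parR (A ≫ C) E = (α_ _ _ _).hom ≫ A ◁ G.parR C E :=
  G.parLiftR_parR _

theorem distR_parL (A : W ⟶ X) (C : X ⟶ Y) (E : Y ⟶ Z) :
    G.perp A ◁ G.distR A C E ≫ G.parL A (C ≫ E) = (α_ _ _ _).inv ≫ G.parL A C ▷ E :=
  G.parLiftL_parL _

/-- `distL` is defined by its effect under `parR`; the effect under `parL`, found by pairing down to
`D`, is needed for the description through `m` and for the mixed coherence laws. -/
theorem distL_parL (A : W ⟶ X) (C : X ⟶ Y) (E : Y ⟶ Z) :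
    G.perp (A ≫ C) ◁ G.distL A C E ≫ G.parL (A ≫ C) E =
      (α_ _ _ _).inv ≫ G.evalL A C ▷ _ ≫ G.parL C E := by
  apply G.evalPerp_ext
  have h : G.perpEval (A ≫ C) = (α_ _ _ _).inv ≫ G.evalL A C ▷ C ≫ G.perpEval C := by
    rw [evalL_perpEval, Iso.inv_hom_id_assoc]
  rw [parL_evalPerp_comp, distL_parR, comp_whiskerRight, comp_whiskerRight, Category.assoc,
    Category.assoc, parL_evalPerp, associator_naturality_left_assoc, ← whisker_exchange_assoc, h]
  simp

theorem distR_parR (A : W ⟶ X) (C : X ⟶ Y) (E : Y ⟶ Z) :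
    G.distR A C E ▷ G.perp (C ≫ E) ≫ G.parR A (C ≫ E) =
      (α_ _ _ _).hom ≫ _ ◁ G.evalR C E ≫ G.parR A C := by
  apply G.perpEval_ext
  have h : G.evalPerp (C ≫ E) = (α_ _ _ _).hom ≫ C ◁ G.evalR C E ≫ G.evalPerp C := by
    rw [evalR_evalPerp, Iso.hom_inv_id_assoc]
  rw [whiskerLeft_comp, Category.assoc, parR_perpEval, associator_inv_naturality_middle_assoc,
    ← comp_whiskerRight_assoc, distR_parL, whiskerLeft_comp, whiskerLeft_comp, Category.assoc,
    Category.assoc, parR_perpEval, associator_inv_naturality_right_assoc, whisker_exchange_assoc,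
    h]
  simp

/-- Under `parL`, both sides become `evalL` followed by the evaluation of `C^⊥ ⊸ E`. -/
theorem fromRhom_distL (A : W ⟶ X) (C : X ⟶ Y) (E : Y ⟶ Z) :
    A ◁ G.fromRhom C E ≫ G.distL A C E = G.rhomDist A C E ≫ G.fromRhom (A ≫ C) E := by
  apply G.parL_ext
  rw [whiskerLeft_comp, Category.assoc, distL_parL, associator_inv_naturality_right_assoc,
    whisker_exchange_assoc, fromRhom_parL, whiskerLeft_comp, Category.assoc, fromRhom_parL,
    rhomDist, rcurry_rev]

theorem fromLhom_distR (A : W ⟶ X) (C : X ⟶ Y) (E : Y ⟶ Z) :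
    G.fromLhom A C ▷ E ≫ G.distR A C E = G.lhomDist A C E ≫ G.fromLhom A (C ≫ E) := by
  apply G.parR_ext
  rw [comp_whiskerRight, Category.assoc, distR_parR, associator_naturality_left_assoc,
    ← whisker_exchange_assoc, fromLhom_parR, comp_whiskerRight, Category.assoc, fromLhom_parR,
    lhomDist, lcurry_lev]

/-- `B` is a linear bicategory with second composition `⊕`. -/
noncomputable def linearBicategory : LinearBicategory G.oplusComposition where
  toSecondBicategory := G.secondBicategory
  distL := G.distL
  distR := G.distR
  -- Naturality, `⊗`-unit and `⊗`-associator laws for one distribution are tested where it is plain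
  -- evaluation: `parR` for `distL`, `parL` for `distR`.
  distL_naturality₁ f C E := G.parR_ext (by
    rw [comp_whiskerRight, Category.assoc, distL_parR, comp_whiskerRight, Category.assoc,
      oplusRight_parR, ← Category.assoc, ← Category.assoc, distL_parR,
      associator_naturality_left, Category.assoc, Category.assoc, whisker_exchange])
  distL_naturality₂ A _ _ g E := G.parR_ext (by
    rw [comp_whiskerRight, Category.assoc, distL_parR, comp_whiskerRight, Category.assoc,
      oplusRight_parR, ← Category.assoc _ _ (A ◁ g), distL_parR,
      associator_naturality_middle_assoc, ← whiskerLeft_comp, oplusRight_parR, whiskerLeft_comp,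
      Category.assoc])
  distL_naturality₃ A C _ _ h := G.parR_ext (by
    rw [comp_whiskerRight, Category.assoc, distL_parR, comp_whiskerRight, Category.assoc,
      oplusLeft_parR, ← whisker_exchange_assoc, distL_parR,
      associator_naturality_middle_assoc, ← whiskerLeft_comp, oplusLeft_parR, whiskerLeft_comp,
      associator_naturality_right_assoc])
  distR_naturality₁ f C E := G.parL_ext (by
    rw [whiskerLeft_comp, Category.assoc, distR_parL, whiskerLeft_comp, Category.assoc,
      oplusRight_parL, whisker_exchange_assoc, distR_parL,
      associator_inv_naturality_middle_assoc, ← comp_whiskerRight, oplusRight_parL,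
      comp_whiskerRight, associator_inv_naturality_left_assoc])
  distR_naturality₂ A _ _ g E := G.parL_ext (by
    rw [whiskerLeft_comp, Category.assoc, distR_parL, whiskerLeft_comp, Category.assoc,
      oplusLeft_parL, ← Category.assoc _ _ (g ▷ E), distR_parL,
      associator_inv_naturality_middle_assoc, ← comp_whiskerRight, oplusLeft_parL,
      comp_whiskerRight, Category.assoc])
  distR_naturality₃ A C _ _ h := G.parL_ext (by
    rw [whiskerLeft_comp, Category.assoc, distR_parL, whiskerLeft_comp, Category.assoc,
      oplusLeft_parL, ← Category.assoc, ← Category.assoc, distR_parL,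
      associator_inv_naturality_right, Category.assoc, Category.assoc, whisker_exchange])
  distL_top C E := G.parR_ext (by
    rw [comp_whiskerRight, Category.assoc, oplusRight_parR, ← Category.assoc, distL_parR]
    simp)
  distR_top A C := G.parL_ext (by
    rw [whiskerLeft_comp, Category.assoc, oplusLeft_parL, ← Category.assoc, distR_parL]
    simp)
  distL_bot A C := by
    change G.distL A C _ ≫ (G.parRightUnitor _).hom = A ◁ (G.parRightUnitor C).hom
    rw [parRightUnitor_hom, parRightUnitor_hom, rightUnitor_inv_naturality_assoc,
      ← whisker_exchange_assoc, distL_parR]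
    simp
  distR_bot C E := by
    change G.distR _ C E ≫ (G.parLeftUnitor _).hom = (G.parLeftUnitor C).hom ▷ E
    rw [parLeftUnitor_hom, parLeftUnitor_hom, leftUnitor_inv_naturality_assoc,
      whisker_exchange_assoc, distR_parL]
    simp
  distL_assoc A C E F := G.parR_ext (by
    simp only [comp_whiskerRight, Category.assoc]
    rw [oplusRight_parR, distL_parR, ← Category.assoc _ _ (α_ A C E).hom, distL_parR,
      associator_naturality_middle_assoc, ← whiskerLeft_comp, distL_parR]
    simp)
  distR_assoc A C E F := G.parL_ext (by
    simp only [whiskerLeft_comp, Category.assoc]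
    rw [oplusLeft_parL, distR_parL, reassoc_of% G.distR_parL,
      associator_inv_naturality_middle_assoc, ← comp_whiskerRight_assoc, distR_parL]
    simp)
  distL_distR A C E F := G.parL_ext (by
    simp only [whiskerLeft_comp, Category.assoc]
    rw [distR_parL, distL_parL, associator_inv_naturality_middle_assoc, ← comp_whiskerRight,
      distL_parL, associator_inv_naturality_right_assoc, whisker_exchange_assoc, distR_parL]
    simp)
  distL_oplus_assoc A C E F := by
    change G.distL A _ F ≫ G.oplusComposition.oplusRight (G.distL A C E) F ≫
      G.parAssocHom (A ≫ C) E F = A ◁ G.parAssocHom C E F ≫ G.distL A C _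
    -- The laws with the associator of `⊕` are tested on both outer sides at once, where that
    -- associator is characterized.
    apply G.parL_parR_ext
    rw [← Category.assoc, comp_parAssocHom_parL_parR, comp_whiskerRight, Category.assoc,
      oplusRight_parR, reassoc_of% G.distL_parR, whiskerLeft_comp, whiskerLeft_comp,
      Category.assoc, Category.assoc, distL_parL, associator_inv_naturality_right_assoc,
      whisker_exchange_assoc, whiskerLeft_comp (G.perp (A ≫ C)) (A ◁ _), Category.assoc,
      distL_parL, associator_inv_naturality_right_assoc, whisker_exchange_assoc,
      comp_whiskerRight, Category.assoc, comp_whiskerRight (G.evalL A C ▷ _), Category.assoc,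
      parAssocHom_parL_parR]
    simp
  distR_oplus_assoc A C E F := by
    change G.parAssocHom A C E ▷ F ≫ G.distR A _ F ≫ G.oplusComposition.oplusLeft A
      (G.distR C E F) = G.distR _ E F ≫ G.parAssocHom A C (E ≫ F)
    apply G.parL_parR_ext
    rw [comp_parAssocHom_parL_parR, distR_parR, whiskerLeft_comp (G.perp A), Category.assoc,
      whiskerLeft_comp (G.perp A) (G.distR _ _ _), Category.assoc, oplusLeft_parL,
      reassoc_of% G.distR_parL, associator_inv_naturality_middle_assoc,
      ← comp_whiskerRight_assoc, ← Category.assoc (α_ _ _ _).inv, comp_whiskerRight,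
      Category.assoc, distR_parR, comp_whiskerRight, Category.assoc,
      associator_naturality_left_assoc, ← whisker_exchange_assoc, parAssocHom_parL_parR]
    simp
  distR_distL A C E F := by
    change G.distL _ E F ≫ G.oplusComposition.oplusRight (G.distR A C E) F ≫
      G.parAssocHom A (C ≫ E) F = G.distR A C _ ≫ G.oplusComposition.oplusLeft A (G.distL C E F)
    apply G.parL_parR_ext
    rw [← Category.assoc, comp_parAssocHom_parL_parR, comp_whiskerRight, Category.assoc,
      oplusRight_parR, reassoc_of% G.distL_parR, whiskerLeft_comp, whiskerLeft_comp,
      Category.assoc, Category.assoc, distR_parL, associator_inv_naturality_right_assoc,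
      whisker_exchange, whiskerLeft_comp (G.perp A) (G.distR _ _ _), Category.assoc,
      oplusLeft_parL, reassoc_of% G.distR_parL, comp_whiskerRight, Category.assoc,
      comp_whiskerRight (_ ▷ _), Category.assoc, distL_parR, associator_naturality_left_assoc]
    simp

end CyclicDualizingFamily

end GirardBicat

theorem mainTheorem1 {B : Type u} [Bicategory.{w, v} B] [GirardBicat.Biclosed B]
    (G : GirardBicat.CyclicDualizingFamily B) :
    (∀ {X Y Z : B} (A : X ⟶ Y) (C : Y ⟶ Z), IsIso (G.fromRhom A C)) ∧
    (∀ {X Y Z : B} (A : X ⟶ Y) (C : Y ⟶ Z), IsIso (G.fromLhom A C)) ∧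
    ∃ L : GirardBicat.LinearBicategory G.oplusComposition,
      (∀ {W X Y Z : B} (A : W ⟶ X) (C : X ⟶ Y) (E : Y ⟶ Z),
        A ◁ G.fromRhom C E ≫ L.distL A C E = G.rhomDist A C E ≫ G.fromRhom (A ≫ C) E) ∧
      (∀ {W X Y Z : B} (A : W ⟶ X) (C : X ⟶ Y) (E : Y ⟶ Z),
        G.fromLhom A C ▷ E ≫ L.distR A C E = G.lhomDist A C E ≫ G.fromLhom A (C ≫ E)) :=
  ⟨G.isIso_fromRhom, G.isIso_fromLhom, G.linearBicategory, G.fromRhom_distL, G.fromLhom_distR⟩
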